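/- Fix integers $d\ge 1$, $1\le s\le d$ and $T\ge 1$. At each stage $t=1,\dots,T$ a decision maker chooses a probability distribution $x_t\in\Delta_d=\{x\in\mathbb{R}_+^d:\sum_{i=1}^d x^{(i)}=1\}$ as a function of the past gain vectors $g_1,\dots,g_{t-1}$ (full information); then an $s$-sparse gain vector $g_t$ is revealed, i.e. $g_t\in[0,1]^d$ has at most $s$ nonzero components. The regret is $$R_T=\max_{1\le i\le d}\sum_{t=1}^T g_t^{(i)}-\sum_{t=1}^T\langle g_t,x_t\rangle ,$$ and the minimax regret is $$v_T^{g,s,d}=\inf_{\text{policies}}\ \sup_{(g_t)_{1\le t\le T}} R_T ,$$ the infimum being over all such policies of the decision maker and the supremum over all sequences of $s$-sparse gain vectors. **Theorem.** $$\liminf_{\substack{s\to+\infty\\ d\ge s}}\ \liminf_{T\to+\infty}\ \frac{v_T^{g,s,d}}{\sqrt{T\log s}}\ \ge\ \frac{\sqrt2}{2},$$ where the outer lower limit is $\displaystyle\lim_{S\to\infty}\ \inf_{s\ge S,\ d\ge s}$ over pairs of integers $(s,d)$; that is, it is uniform in $d\ge s$. -/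

import Mathlib

open Filter

noncomputable section

/-- The `s`-sparse gain vectors: vectors in `[0,1]^d` with at most `s` nonzero components. -/
def SparseGain (s d : ℕ) : Type :=
  {g : Fin d → ℝ // (∀ i, g i ∈ Set.Icc (0 : ℝ) 1) ∧ {i | g i ≠ 0}.ncard ≤ s}

/-- A full-information policy over `T` stages: at every stage `t` it picks a probability
distribution on the `d` decisions, as a function of the gain vectors of all earlier stages. -/
def Policy (T s d : ℕ) : Type :=
  (t : Fin T) → (Fin (t : ℕ) → SparseGain s d) → stdSimplex ℝ (Fin d)

/-- The distribution `x_t` that the policy `σ` plays at stage `t` against the gain vectors `g`. -/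
def Policy.play {T s d : ℕ} (σ : Policy T s d) (g : Fin T → SparseGain s d) (t : Fin T) :
    Fin d → ℝ :=
  (σ t (fun k => g (Fin.castLE t.isLt.le k))).1

/-- The regret `R_T = max_i ∑_t g_t^{(i)} - ∑_t ⟨g_t, x_t⟩`. -/
def gainRegret {T s d : ℕ} (σ : Policy T s d) (g : Fin T → SparseGain s d) : ℝ :=
  (⨆ i : Fin d, ∑ t : Fin T, (g t).1 i) - ∑ t : Fin T, ∑ i : Fin d, (g t).1 i * σ.play g t i

/-- The minimax regret of the `T`-stage problem with `s`-sparse gains and `d` decisions. -/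
def minimaxGainRegret (T s d : ℕ) : ℝ :=
  ⨅ σ : Policy T s d, ⨆ g : Fin T → SparseGain s d, gainRegret σ g

/-- The filter on pairs `(s, d)` for "`s → ∞` with `d ≥ s`". -/
def sparsityAtTop : Filter (ℕ × ℕ) :=
  comap Prod.fst atTop ⊓ 𝓟 {p | p.1 ≤ p.2}

/-! The infimum, the suprema and the filter above are not degenerate. -/

instance SparseGain.instNonempty (s d : ℕ) : Nonempty (SparseGain s d) :=
  ⟨⟨fun _ => 0, by simp, by simp⟩⟩

theorem Policy.nonempty {T s d : ℕ} (hd : 0 < d) : Nonempty (Policy T s d) :=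
  ⟨fun _ _ => ⟨Pi.single ⟨0, hd⟩ 1, single_mem_stdSimplex ℝ _⟩⟩

theorem abs_gainRegret_le {T s d : ℕ} (σ : Policy T s d) (g : Fin T → SparseGain s d) :
    |gainRegret σ g| ≤ T := by
  have h0 : ∀ t i, 0 ≤ (g t).1 i := fun t i => ((g t).2.1 i).1
  have h1 : ∀ t i, (g t).1 i ≤ 1 := fun t i => ((g t).2.1 i).2
  have hx : ∀ t i, 0 ≤ σ.play g t i := fun t i => (σ t _).2.1 i
  have hs : ∀ t, ∑ i, σ.play g t i = 1 := fun t => (σ t _).2.2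
  have hA0 : 0 ≤ ⨆ i : Fin d, ∑ t : Fin T, (g t).1 i :=
    Real.iSup_nonneg fun i => Finset.sum_nonneg fun t _ => h0 t i
  have hA1 : (⨆ i : Fin d, ∑ t : Fin T, (g t).1 i) ≤ T :=
    Real.iSup_le (fun i => (Finset.sum_le_sum fun t _ => h1 t i).trans (by simp)) (by simp)
  have hB0 : 0 ≤ ∑ t : Fin T, ∑ i : Fin d, (g t).1 i * σ.play g t i :=
    Finset.sum_nonneg fun t _ => Finset.sum_nonneg fun i _ => mul_nonneg (h0 t i) (hx t i)
  have hB1 : ∑ t : Fin T, ∑ i : Fin d, (g t).1 i * σ.play g t i ≤ T := by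
    have : ∀ t : Fin T, ∑ i : Fin d, (g t).1 i * σ.play g t i ≤ 1 := fun t =>
      (Finset.sum_le_sum fun i _ => mul_le_of_le_one_left (hx t i) (h1 t i)).trans (hs t).le
    exact (Finset.sum_le_sum fun t _ => this t).trans (by simp)
  unfold gainRegret
  rw [abs_le]
  constructor <;> linarith

theorem bddAbove_gainRegret {T s d : ℕ} (σ : Policy T s d) :
    BddAbove (Set.range (gainRegret σ)) :=
  ⟨T, by rintro _ ⟨g, rfl⟩; exact (abs_le.1 (abs_gainRegret_le σ g)).2⟩

theorem bddBelow_iSup_gainRegret (T s d : ℕ) :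
    BddBelow (Set.range fun σ : Policy T s d => ⨆ g, gainRegret σ g) :=
  ⟨-(T : ℝ), by
    rintro _ ⟨σ, rfl⟩
    obtain ⟨g⟩ : Nonempty (Fin T → SparseGain s d) := inferInstance
    exact (abs_le.1 (abs_gainRegret_le σ g)).1.trans (le_ciSup (bddAbove_gainRegret σ) g)⟩

theorem eventually_sparsityAtTop {P : ℕ × ℕ → Prop} :
    (∀ᶠ p in sparsityAtTop, P p) ↔ ∃ S, ∀ s d, S ≤ s → s ≤ d → P (s, d) := by
  have hb : (sparsityAtTop).HasBasis (fun _ : ℕ => True)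
      (fun S => Prod.fst ⁻¹' Set.Ici S ∩ {p : ℕ × ℕ | p.1 ≤ p.2}) :=
    (atTop_basis.comap Prod.fst).inf_principal _
  rw [hb.eventually_iff]
  constructor
  · rintro ⟨S, -, h⟩
    exact ⟨S, fun s d hs hd => h ⟨hs, hd⟩⟩
  · rintro ⟨S, h⟩
    exact ⟨S, trivial, fun p hp => h p.1 p.2 hp.1 hp.2⟩

instance sparsityAtTop_neBot : sparsityAtTop.NeBot := by
  rw [neBot_iff]
  intro h
  have hF : ∀ᶠ _p in sparsityAtTop, False := by rw [h]; exact eventually_bot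
  obtain ⟨S, hS⟩ := eventually_sparsityAtTop.1 hF
  exact hS S S le_rfl le_rfl

end

/-! Play independent fair bits on the first `s` coordinates and zeros elsewhere. A policy earns at
most `T / 2` on average, since `x_t` does not depend on the bits of stage `t`. The best coordinate
earns at least `T / 2` plus half the maximum of `s` independent sign sums. If `p` is a lower bound
for the probability that one sum exceeds `a√T`, this maximum has mean at least `a√T (1 - exp (-(s -
1) p))`. Some table does at least as badly for the policy as the average, see
`le_minimaxGainRegret`.

For fixed `s`, the central limit theorem gives `p = exp (-(a + 1)^2 / 2) / 3` for large `T`. With `a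
= b√(log s) - 1` and `b < √2`, `s p` is of order `s^(1 - b^2 / 2)`, which diverges, so the ratio is
asymptotically at least `b / 2`. The bound does not involve `d`, hence the uniformity. -/

/-- The random sign attached to a bit. -/
noncomputable def boolSign (b : Bool) : ℝ := if b then 1 else -1

theorem boolSign_not (b : Bool) : boolSign (!b) = -boolSign b := by
  cases b <;> simp [boolSign]

/-- The sum of the signs of a finite sequence of bits. -/
noncomputable def signSum {T : ℕ} (x : Fin T → Bool) : ℝ := ∑ t, boolSign (x t)

theorem signSum_not {T : ℕ} (x : Fin T → Bool) : signSum (fun t => !x t) = -signSum x := by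
  simp [signSum, boolSign_not]

/-- The sequences of bits whose sign sum exceeds `a √T`. -/
noncomputable def largeSignSum (T : ℕ) (a : ℝ) : Finset (Fin T → Bool) :=
  open Classical in Finset.univ.filter fun x => a * √T < signSum x

theorem mem_largeSignSum {T : ℕ} {a : ℝ} {x : Fin T → Bool} :
    x ∈ largeSignSum T a ↔ a * √T < signSum x := by
  classical
  simp [largeSignSum]

/-! ### Gaussian lower bound for the tail of a sign sum -/

section CentralLimit

open MeasureTheory ProbabilityTheory

/-- The law of a fair bit. -/
noncomputable def fairBit : Measure Bool := (PMF.uniformOfFintype Bool).toMeasure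

instance : IsProbabilityMeasure fairBit := by unfold fairBit; infer_instance

theorem fairBit_singleton (b : Bool) : fairBit {b} = 2⁻¹ := by
  rw [fairBit, PMF.toMeasure_apply_singleton _ _ (measurableSet_singleton b)]
  simp

/-- The law of a sequence of independent fair bits. -/
noncomputable def fairBits : Measure (ℕ → Bool) := Measure.infinitePi fun _ => fairBit

instance : IsProbabilityMeasure fairBits := by unfold fairBits; infer_instance

theorem map_eval_fairBits (k : ℕ) : fairBits.map (fun ω => ω k) = fairBit :=
  (measurePreserving_eval_infinitePi (fun _ : ℕ => fairBit) k).map_eq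

theorem iIndepFun_eval_fairBits : iIndepFun (fun (k : ℕ) (ω : ℕ → Bool) => ω k) fairBits :=
  iIndepFun_infinitePi (X := fun _ b => b) (fun _ => measurable_id)

theorem map_restrict_fairBits (T : ℕ) :
    fairBits.map (fun ω (t : Fin T) => ω t) = Measure.pi fun _ => fairBit := by
  have h := iIndepFun_eval_fairBits.precomp (g := fun t : Fin T => (t : ℕ)) Fin.val_injective
  have h2 := (iIndepFun_iff_map_fun_eq_pi_map fun t => (measurable_pi_apply _).aemeasurable).1 h
  simpa [map_eval_fairBits] using h2

theorem pi_fairBit_apply {T : ℕ} (A : Finset (Fin T → Bool)) :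
    (Measure.pi fun _ : Fin T => fairBit) (A : Set (Fin T → Bool)) = A.card * (2⁻¹) ^ T := by
  rw [← sum_measure_singleton]
  simp [Measure.pi_singleton, fairBit_singleton]

theorem fairBits_signSum_gt {T : ℕ} (hT : 0 < T) (a : ℝ) :
    fairBits {ω | a < (√T)⁻¹ * ∑ k ∈ Finset.range T, boolSign (ω k)} =
      (largeSignSum T a).card * (2⁻¹) ^ T := by
  rw [← pi_fairBit_apply, ← map_restrict_fairBits,
    Measure.map_apply (by fun_prop) (Finset.measurableSet _)]
  congr 1
  ext ω
  have : 0 < √(T : ℝ) := by positivity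
  simp only [Set.mem_ofPred_eq, Set.mem_preimage, Finset.mem_coe, mem_largeSignSum, signSum]
  rw [Fin.sum_univ_eq_sum_range (fun k => boolSign (ω k)), inv_mul_eq_div, lt_div_iff₀ this]

theorem tendstoInDistribution_signSum :
    TendstoInDistribution
      (fun (n : ℕ) (ω : ℕ → Bool) => (√n)⁻¹ * ∑ k ∈ Finset.range n, boolSign (ω k)) atTop
      (id : ℝ → ℝ) (fun _ => fairBits) (gaussianReal 0 1) := by
  have hm : Measurable boolSign := measurable_of_finite _
  have hmk (k : ℕ) : Measurable fun ω : ℕ → Bool => boolSign (ω k) :=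
    hm.comp (measurable_pi_apply k)
  have hint (f : Bool → ℝ) : ∫ ω, f (ω 0) ∂fairBits = (f true + f false) / 2 := by
    rw [← integral_map (φ := fun ω : ℕ → Bool => ω 0) (f := f)
      (measurable_pi_apply 0).aemeasurable
      (measurable_of_finite f).aestronglyMeasurable,
      map_eval_fairBits, integral_fintype .of_finite]
    simp [measureReal_def, fairBit_singleton]
    ring
  refine tendstoInDistribution_inv_sqrt_mul_sum (X := fun (k : ℕ) (ω : ℕ → Bool) => boolSign (ω k))
    ⟨by fun_prop, by simp⟩ ?_ ?_ ?_ fun i => ⟨(hmk i).aemeasurable, (hmk 0).aemeasurable, ?_⟩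
  · rw [hint boolSign]; simp [boolSign]
  · simp only [Pi.pow_apply]
    rw [hint (fun b => boolSign b ^ 2)]; norm_num [boolSign]
  · exact iIndepFun_eval_fairBits.comp (fun _ => boolSign) fun _ => hm
  · have h (k : ℕ) : fairBits.map (fun ω => boolSign (ω k)) = fairBit.map boolSign := by
      rw [← map_eval_fairBits k, Measure.map_map hm (measurable_pi_apply k)]; rfl
    rw [h, h]

/-- On `(a, a + 1]` the density is at least its value at `a + 1`, and `√(2π) < 3`. Strictness is
what lets the bound pass from the liminf to all large `T`. -/
theorem exp_lt_gaussianReal_Ioi {a : ℝ} (ha : 0 ≤ a) :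
    ENNReal.ofReal (Real.exp (-(a + 1) ^ 2 / 2) / 3) < gaussianReal 0 1 (Set.Ioi a) := by
  have hpi : √(2 * Real.pi) < 3 := by
    rw [Real.sqrt_lt' (by norm_num)]; nlinarith [Real.pi_lt_four]
  have hpi0 : 0 < √(2 * Real.pi) := by positivity
  have h1 : ENNReal.ofReal (Real.exp (-(a + 1) ^ 2 / 2) / √(2 * Real.pi)) ≤
      gaussianReal 0 1 (Set.Ioi a) := by
    calc ENNReal.ofReal (Real.exp (-(a + 1) ^ 2 / 2) / √(2 * Real.pi))
        = ∫⁻ x in Set.Ioc a (a + 1),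
            ENNReal.ofReal (Real.exp (-(a + 1) ^ 2 / 2) / √(2 * Real.pi)) := by simp
      _ ≤ ∫⁻ x in Set.Ioc a (a + 1), gaussianPDF 0 1 x := by
          refine setLIntegral_mono (measurable_gaussianPDF _ _) fun x hx => ?_
          refine ENNReal.ofReal_le_ofReal ?_
          simp only [gaussianPDFReal, NNReal.coe_one, mul_one, sub_zero]
          rw [div_eq_inv_mul]
          gcongr
          · linarith [hx.1]
          · exact hx.2
      _ ≤ ∫⁻ x in Set.Ioi a, gaussianPDF 0 1 x :=
          lintegral_mono_set Set.Ioc_subset_Ioi_self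
      _ = _ := (gaussianReal_apply 0 one_ne_zero _).symm
  refine lt_of_lt_of_le ?_ h1
  rw [ENNReal.ofReal_lt_ofReal_iff (by positivity)]
  gcongr

theorem eventually_card_largeSignSum {a : ℝ} (ha : 0 ≤ a) :
    ∀ᶠ T : ℕ in atTop,
      Real.exp (-(a + 1) ^ 2 / 2) / 3 ≤ ((largeSignSum T a).card : ℝ) / 2 ^ T := by
  have h := ProbabilityMeasure.le_liminf_measure_open_of_tendsto
    tendstoInDistribution_signSum.tendsto (isOpen_Ioi (a := a))
  have h2 := eventually_lt_of_lt_liminf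
    ((exp_lt_gaussianReal_Ioi ha).trans_le (by simpa using h))
  filter_upwards [h2, eventually_gt_atTop 0] with T hT hT0
  have hm : Measurable boolSign := measurable_of_finite _
  rw [Measure.map_apply (by fun_prop) measurableSet_Ioi] at hT
  have hT' := hT.le.trans_eq (fairBits_signSum_gt hT0 a)
  rw [ENNReal.ofReal_le_iff_le_toReal (by finiteness)] at hT'
  simpa [div_eq_mul_inv] using hT'

end CentralLimit

/-! ### Averaging over tables of bits -/

theorem sum_eq_zero_of_involutive {α : Type*} [Fintype α] {φ : α → α}
    (hφ : Function.Involutive φ) {f : α → ℝ} (hf : ∀ x, f (φ x) = -f x) : ∑ x, f x = 0 := by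
  have h := Equiv.sum_comp hφ.toPerm f
  simp only [Function.Involutive.coe_toPerm, hf, Finset.sum_neg_distrib] at h
  linarith

/-- Flip the bits of `e` marked by `w`. -/
def flipBits {s T : ℕ} (w e : Fin s → Fin T → Bool) : Fin s → Fin T → Bool :=
  fun i t => xor (e i t) (w i t)

theorem flipBits_involutive {s T : ℕ} (w : Fin s → Fin T → Bool) :
    Function.Involutive (flipBits w) := fun e => by
  funext i t; simp [flipBits]

/-- The `s`-sparse gain vector whose first `s` components are the given bits. -/
noncomputable def bitGain {s d : ℕ} (x : Fin s → Bool) : SparseGain s d :=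
  ⟨fun i => if h : i.1 < s then (if x ⟨i, h⟩ then 1 else 0) else 0, by
    refine ⟨fun i => by dsimp only; split_ifs <;> simp, ?_⟩
    rw [← Set.ncard_image_of_injective _ Fin.val_injective]
    calc _ ≤ ((Finset.range s : Finset ℕ) : Set ℕ).ncard := by
          refine Set.ncard_le_ncard ?_ (Finset.finite_toSet _)
          rintro _ ⟨i, hi, rfl⟩
          by_contra h
          simp at h
          simp [h] at hi
      _ = s := by rw [Set.ncard_coe_finset, Finset.card_range]⟩

/-- The gain vectors at all stages read off from a table of bits. -/
noncomputable def tableGain {s T : ℕ} (d : ℕ) (e : Fin s → Fin T → Bool) :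
    Fin T → SparseGain s d := fun t => bitGain fun i => e i t

theorem two_mul_tableGain {s T d : ℕ} (e : Fin s → Fin T → Bool) (t : Fin T) (i : Fin d)
    (h : i.1 < s) : 2 * (tableGain d e t).1 i = 1 + boolSign (e ⟨i, h⟩ t) := by
  simp only [tableGain, bitGain, h, dite_true, boolSign]
  split_ifs <;> norm_num

theorem tableGain_eq_zero {s T d : ℕ} (e : Fin s → Fin T → Bool) (t : Fin T) (i : Fin d)
    (h : ¬ i.1 < s) : (tableGain d e t).1 i = 0 := by
  simp [tableGain, bitGain, h]

/-- Flipping the single bit `(i, t)` negates `2 g - 1` and preserves `x_t`, so these terms cancel;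
mass placed on coordinates beyond `s` only loses. -/
theorem sum_tableGain_mul_play_le {s T d : ℕ} (σ : Policy T s d) :
    2 * ∑ e : Fin s → Fin T → Bool, ∑ t, ∑ i, (tableGain d e t).1 i * σ.play (tableGain d e) t i
      ≤ Fintype.card (Fin s → Fin T → Bool) * T := by
  have key (t : Fin T) (i : Fin d) :
      ∑ e : Fin s → Fin T → Bool,
        (2 * (tableGain d e t).1 i - 1) * σ.play (tableGain d e) t i ≤ 0 := by
    by_cases h : i.1 < s
    · refine (sum_eq_zero_of_involutive
        (flipBits_involutive fun j u => decide (j = ⟨i, h⟩ ∧ u = t)) fun e => ?_).le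
      rw [two_mul_tableGain _ _ _ h, two_mul_tableGain _ _ _ h]
      have hp : σ.play (tableGain d (flipBits (fun j u => decide (j = ⟨i, h⟩ ∧ u = t)) e)) t
          = σ.play (tableGain d e) t := by
        unfold Policy.play
        congr 2
        funext k
        simp only [tableGain]
        congr 1
        funext j
        have : Fin.castLE t.isLt.le k ≠ t := fun hk => by
          have := congrArg Fin.val hk
          simp at this
          omega
        simp [flipBits, this]
      rw [hp]
      simp [flipBits, boolSign_not]
    · refine Finset.sum_nonpos fun e _ => ?_
      rw [tableGain_eq_zero _ _ _ h]
      have : 0 ≤ σ.play (tableGain d e) t i := (σ t _).2.1 i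
      linarith
  have hs (e : Fin s → Fin T → Bool) (t : Fin T) : ∑ i, σ.play (tableGain d e) t i = 1 :=
    (σ t _).2.2
  have h := Finset.sum_nonpos fun (t : Fin T) (_ : t ∈ Finset.univ) =>
    Finset.sum_nonpos fun (i : Fin d) (_ : i ∈ Finset.univ) => key t i
  have e1 : ∑ t : Fin T, ∑ i : Fin d, ∑ e : Fin s → Fin T → Bool,
        (2 * (tableGain d e t).1 i - 1) * σ.play (tableGain d e) t i
      = ∑ e : Fin s → Fin T → Bool, ∑ t : Fin T, ∑ i : Fin d,
        (2 * (tableGain d e t).1 i - 1) * σ.play (tableGain d e) t i :=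
    (Finset.sum_congr rfl fun t _ => Finset.sum_comm).trans Finset.sum_comm
  rw [e1] at h
  simp only [sub_mul, one_mul, Finset.sum_sub_distrib, hs, mul_assoc, ← Finset.mul_sum] at h
  simp only [Finset.sum_const, Finset.card_univ, Fintype.card_fin, nsmul_eq_mul, mul_one] at h
  linarith

/-- Lower bound for the sum over all tables of the largest column sum. -/
theorem le_sum_of_forall_signSum_le {r T : ℕ} {a : ℝ} (ha : 0 ≤ a)
    {M : (Fin (r + 1) → Fin T → Bool) → ℝ} (hM : ∀ e i, signSum (e i) ≤ M e) {p : ℝ}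
    (hp : p ≤ ((largeSignSum T a).card : ℝ) / 2 ^ T) :
    a * √T * (1 - Real.exp (-(r * p))) * Fintype.card (Fin (r + 1) → Fin T → Bool) ≤
      ∑ e, M e := by
  classical
  set L := largeSignSum T a
  set N : ℝ := 2 ^ T with hN
  have hN0 : 0 < N := by positivity
  -- `B` is the event that no row other than row 0 is large. Row 0 stays unconstrained, so its sign
  -- sum averages to zero on `B` and bounds `M` below there at no cost; this is why the exponent has
  -- `r`, not `r + 1`.
  let B : Finset (Fin (r + 1) → Fin T → Bool) :=
    Fintype.piFinset fun i => if i = 0 then Finset.univ else Lᶜ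
  have hB (e) : e ∈ B ↔ ∀ i, i ≠ 0 → e i ∉ L := by
    simp only [B, Fintype.mem_piFinset]
    refine forall_congr' fun i => ?_
    by_cases h : i = 0 <;> simp [h]
  have hcard : (Fintype.card (Fin (r + 1) → Fin T → Bool) : ℝ) = N * N ^ r := by
    simp [hN, pow_succ, mul_comm]
  have hLc : ((Lᶜ.card : ℕ) : ℝ) = N * (1 - L.card / N) := by
    have : (L.card : ℝ) + Lᶜ.card = N := by
      rw [hN]; exact_mod_cast (by simp)
    field_simp
    linarith
  have hBcard : (B.card : ℝ) ≤ N * N ^ r * Real.exp (-(r * p)) := by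
    have h1 : (B.card : ℝ) = N * (Lᶜ.card : ℝ) ^ r := by
      simp [B, Fintype.card_piFinset, Fin.prod_univ_succ, hN]
    have h2 : (Lᶜ.card : ℝ) ≤ N * Real.exp (-p) := by
      rw [hLc]
      gcongr
      linarith [Real.one_sub_le_exp_neg p]
    rw [h1, mul_assoc]
    gcongr
    calc (Lᶜ.card : ℝ) ^ r ≤ (N * Real.exp (-p)) ^ r := by gcongr
      _ = _ := by rw [mul_pow, ← Real.exp_nat_mul]; ring_nf
  have hzero : ∑ e, (if e ∈ B then signSum (e 0) else 0) = 0 := by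
    refine sum_eq_zero_of_involutive (flipBits_involutive fun j _ => decide (j = 0)) fun e => ?_
    have h1 : flipBits (fun j _ => decide (j = 0)) e ∈ B ↔ e ∈ B := by
      rw [hB, hB]
      refine forall_congr' fun i => imp_congr_right fun hi => ?_
      have : flipBits (fun j _ => decide (j = 0)) e i = e i := by
        funext t; simp [flipBits, hi]
      rw [this]
    have h2 : flipBits (fun j _ => decide (j = 0)) e 0 = fun t => !e 0 t := by
      funext t; simp [flipBits]
    rw [h2, signSum_not]
    simp only [h1]
    split_ifs <;> simp
  have hpt (e) : (if e ∈ B then signSum (e 0) else 0) + a * √T * (if e ∈ B then 0 else 1)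
      ≤ M e := by
    split_ifs with h
    · simpa using hM e 0
    · rw [hB] at h
      push Not at h
      obtain ⟨i, -, hi⟩ := h
      have := (mem_largeSignSum.1 hi).le.trans (hM e i)
      simpa using this
  have hcompl : ∑ e : Fin (r + 1) → Fin T → Bool, (if e ∈ B then (0 : ℝ) else 1)
      = N * N ^ r - B.card := by
    rw [← hcard]
    have : ∀ e : Fin (r + 1) → Fin T → Bool, (if e ∈ B then (0 : ℝ) else 1)
      = 1 - if e ∈ B then 1 else 0 := fun e => by split_ifs <;> simp
    simp only [this, Finset.sum_sub_distrib]
    simp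
  calc _ = a * √T * (N * N ^ r - N * N ^ r * Real.exp (-(r * p))) := by rw [hcard]; ring
    _ ≤ a * √T * (N * N ^ r - B.card) := by gcongr
    _ = ∑ e, ((if e ∈ B then signSum (e 0) else 0) + a * √T * (if e ∈ B then 0 else 1)) := by
      rw [Finset.sum_add_distrib, hzero, ← Finset.mul_sum, hcompl, zero_add]
    _ ≤ _ := Finset.sum_le_sum fun e _ => hpt e

/-! ### From averages to the minimax regret, and the limit in `s` -/

theorem le_minimaxGainRegret {r T d : ℕ} (hd : r + 1 ≤ d) {a p : ℝ} (ha : 0 ≤ a)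
    (hp : p ≤ ((largeSignSum T a).card : ℝ) / 2 ^ T) :
    a * √T / 2 * (1 - Real.exp (-(r * p))) ≤ minimaxGainRegret T (r + 1) d := by
  have : Nonempty (Policy T (r + 1) d) := Policy.nonempty (by omega)
  refine le_ciInf fun σ => ?_
  set R := ⨆ g, gainRegret σ g
  let M (e : Fin (r + 1) → Fin T → Bool) : ℝ :=
    2 * (⨆ i : Fin d, ∑ t : Fin T, (tableGain d e t).1 i) - T
  have hM (e i) : signSum (e i) ≤ M e := by
    have h1 := le_ciSup (f := fun i : Fin d => ∑ t : Fin T, (tableGain d e t).1 i)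
      (Set.finite_range _).bddAbove (Fin.castLE hd i)
    have h2 : 2 * ∑ t : Fin T, (tableGain d e t).1 (Fin.castLE hd i) = T + signSum (e i) := by
      rw [Finset.mul_sum]
      simp only [two_mul_tableGain _ _ (Fin.castLE hd i) i.isLt, Finset.sum_add_distrib, signSum]
      simp
    simp only [M]
    linarith
  have h1 := le_sum_of_forall_signSum_le ha hM hp
  have h2 := sum_tableGain_mul_play_le σ
  have h3 : ∑ e, gainRegret σ (tableGain d e)
      ≤ ∑ _e : Fin (r + 1) → Fin T → Bool, R :=
    Finset.sum_le_sum fun e _ => le_ciSup (bddAbove_gainRegret σ) _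
  set C : ℝ := (Fintype.card (Fin (r + 1) → Fin T → Bool) : ℝ) with hC
  have hC0 : 0 < C := by rw [hC]; exact_mod_cast Fintype.card_pos
  simp only [gainRegret, Finset.sum_sub_distrib, Finset.sum_const, Finset.card_univ,
    nsmul_eq_mul, ← hC] at h3
  simp only [M, Finset.sum_sub_distrib, ← Finset.mul_sum, Finset.sum_const, Finset.card_univ,
    nsmul_eq_mul, ← hC] at h1
  refine le_of_mul_le_mul_right ?_ hC0
  linarith

theorem tendsto_minimax_bound {b : ℝ} (hb0 : 0 ≤ b) (hb : b < √2) :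
    Tendsto (fun s : ℕ => (b / 2 - (√(Real.log s))⁻¹ / 2) *
      (1 - Real.exp (-((s - 1 : ℝ) * (Real.exp (-(b * √(Real.log s)) ^ 2 / 2) / 3)))))
      atTop (nhds (b / 2)) := by
  have hsq : b ^ 2 < 2 := by
    have := pow_lt_pow_left₀ hb hb0 two_ne_zero
    simpa using this
  have hl : Tendsto (fun s : ℕ => (√(Real.log s))⁻¹) atTop (nhds 0) :=
    tendsto_inv_atTop_zero.comp (Real.tendsto_sqrt_atTop.comp
      (Real.tendsto_log_atTop.comp tendsto_natCast_atTop_atTop))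
  have hg : Tendsto (fun s : ℕ =>
      (s - 1 : ℝ) * (Real.exp (-(b * √(Real.log s)) ^ 2 / 2) / 3)) atTop atTop := by
    -- The 6 is the 3 of the tail bound times 2, from `s - 1 ≥ s / 2`.
    have h1 : Tendsto (fun s : ℕ => (s : ℝ) ^ (1 - b ^ 2 / 2) / 6) atTop atTop :=
      ((tendsto_rpow_atTop (by linarith)).comp tendsto_natCast_atTop_atTop).atTop_div_const
        (by norm_num)
    refine tendsto_atTop_mono' _ ?_ h1
    filter_upwards [eventually_ge_atTop 2] with s hs
    have hs' : (2 : ℝ) ≤ s := by exact_mod_cast hs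
    have hlog : 0 ≤ Real.log s := Real.log_nonneg (by linarith)
    have he : Real.exp (-(b * √(Real.log s)) ^ 2 / 2) = (s : ℝ) ^ (-(b ^ 2 / 2)) := by
      rw [Real.rpow_def_of_pos (by linarith)]
      congr 1
      rw [neg_div, mul_pow, Real.sq_sqrt hlog]
      ring
    rw [he, sub_eq_add_neg 1, Real.rpow_add (by linarith), Real.rpow_one]
    have : 0 < (s : ℝ) ^ (-(b ^ 2 / 2)) := by positivity
    nlinarith
  have h2 := (Real.tendsto_exp_neg_atTop_nhds_zero.comp hg).const_sub 1
  have h3 := (tendsto_const_nhds (x := b / 2)).sub (hl.div_const 2)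
  simpa using h3.mul h2

theorem mainTheorem4 :
    ((Real.sqrt 2 / 2 : ℝ) : EReal) ≤
      liminf (fun p : ℕ × ℕ =>
        liminf (fun T : ℕ =>
          ((minimaxGainRegret T p.1 p.2 / Real.sqrt ((T : ℝ) * Real.log (p.1 : ℝ)) : ℝ) : EReal))
          atTop)
        sparsityAtTop := by
  refine EReal.ge_of_forall_gt_iff_ge.1 fun c hc => ?_
  have hc' : c < √2 / 2 := by exact_mod_cast hc
  obtain ⟨b, hb1, hb2⟩ := exists_between (show max (2 * c) 0 < √2 from
    max_lt (by linarith) (by positivity))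
  have hb0 : 0 < b := (le_max_right _ _).trans_lt hb1
  have hcb : c < b / 2 := by linarith [(le_max_left (2 * c) 0).trans_lt hb1]
  have hlog : Tendsto (fun s : ℕ => b * √(Real.log s)) atTop atTop :=
    (Real.tendsto_sqrt_atTop.comp
      (Real.tendsto_log_atTop.comp tendsto_natCast_atTop_atTop)).const_mul_atTop hb0
  -- The threshold `S` is chosen before `d`; it also ensures `a = b√(log s) - 1 ≥ 0` and `log s >
  -- 0`.
  obtain ⟨S, hS⟩ := eventually_atTop.1
    (((tendsto_minimax_bound hb0.le hb2).eventually_const_lt hcb).and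
      ((hlog.eventually_ge_atTop 1).and (eventually_ge_atTop 2)))
  refine le_liminf_of_le (h := eventually_sparsityAtTop.2 ⟨S, fun s d hs hd => ?_⟩)
  obtain ⟨h1, h2, h3⟩ := hS s hs
  refine le_liminf_of_le (h := ?_)
  have ha : 0 ≤ b * √(Real.log s) - 1 := by linarith
  filter_upwards [eventually_card_largeSignSum ha, eventually_gt_atTop 0] with T hT hT0
  obtain ⟨r, rfl⟩ : ∃ r, s = r + 1 := ⟨s - 1, by omega⟩
  have h := le_minimaxGainRegret hd ha hT
  have hl : 0 < Real.log ((r + 1 : ℕ) : ℝ) := Real.log_pos (by exact_mod_cast h3)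
  have hT1 : 0 < √(T : ℝ) := by positivity
  have hl1 : 0 < √(Real.log ((r + 1 : ℕ) : ℝ)) := by positivity
  rw [EReal.coe_le_coe_iff, Real.sqrt_mul (by positivity)]
  refine h1.le.trans ?_
  rw [le_div_iff₀ (by positivity)]
  refine le_trans (le_of_eq ?_) h
  rw [sub_add_cancel, show ((r + 1 : ℕ) : ℝ) - 1 = r by push_cast; ring]
  generalize Real.exp (-(r * _)) = E
  field_simp
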